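/- Let $n\in\mathbb{N}$, let $dV$ be Lebesgue measure on $\mathbb{C}^n$, and let $d\mu(z)=\pi^{-n}e^{-|z|^2}dV(z)$ be the normalized Gaussian measure. The Fock space $F^2=L^2(\mathbb{C}^n,d\mu)\cap H(\mathbb{C}^n)$ is the space of all entire functions on $\mathbb{C}^n$ that are square integrable with respect to $\mu$, and $P$ denotes the orthogonal projection of $L^2(\mathbb{C}^n,d\mu)$ onto $F^2$, $$PF(z)=\int_{\mathbb{C}^n}F(w)\,e^{z\cdot\overline{w}}\,d\mu(w),\qquad z\cdot\overline w=\sum_{i=1}^n z_i\overline{w_i}.$$ For a measurable function $a$ on $\mathbb{C}^n$, the Toeplitz operator $T_a$ is the (possibly unbounded) operator $T_ah=P(ah)$ on $F^2$ with domain $\{h\in F^2: ah\in L^2(\mathbb{C}^n,d\mu)\}$; the product $T_aT_b$ has domain $\{h\in\operatorname{dom}T_b: T_bh\in\operatorname{dom}T_a\}$, and $T_aT_b=0$ means that $T_aT_bh=0$ for every $h$ in this domain. Let $\mathrm{Sym}(\mathbb{C}^n)$ be the set of measurable $a:\mathbb{C}^n\to\mathbb{C}$ such that $a(z)e^{-c|z|^2}$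 is essentially bounded on $\mathbb{C}^n$ for every $c>0$. Let $f,g,u,v$ be entire functions in $\mathrm{Sym}(\mathbb{C}^n)$, and put $\varphi=f+\overline{g}$ and $\psi=u+\overline{v}$. Then $T_\varphi T_\psi=0$ if and only if $\varphi=0$ or $\psi=0$. -/

import Mathlib

open MeasureTheory
open scoped ComplexConjugate

noncomputable section

namespace Fock

/-- `|z|² = ∑ |z_i|²`; the Euclidean square norm, written out because `Fin n → ℂ` carries the
sup norm. -/
def normSq {n : ℕ} (z : Fin n → ℂ) : ℝ := ∑ i, ‖z i‖ ^ 2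

/-- The normalized Gaussian measure `dμ(z) = π⁻ⁿ exp(-|z|²) dV(z)` on `ℂⁿ`, where `dV` is
Lebesgue measure. -/
def gaussian (n : ℕ) : Measure (Fin n → ℂ) :=
  volume.withDensity fun z => ENNReal.ofReal ((1 / Real.pi ^ n) * Real.exp (-normSq z))

/-- The reproducing kernel `K(z, w) = exp(z · w̄)`. -/
def kernel {n : ℕ} (z w : Fin n → ℂ) : ℂ := Complex.exp (∑ i, z i * conj (w i))

/-- The Fock space `F² = L²(ℂⁿ, dμ) ∩ H(ℂⁿ)`. -/
def space (n : ℕ) : Submodule ℂ ((Fin n → ℂ) → ℂ) where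
  carrier := {h | Differentiable ℂ h ∧ MemLp h 2 (gaussian n)}
  add_mem' ha hb := ⟨ha.1.add hb.1, ha.2.add hb.2⟩
  zero_mem' := ⟨differentiable_const 0, MemLp.zero⟩
  smul_mem' c _ ha := ⟨ha.1.const_smul c, ha.2.const_smul c⟩

/-- The orthogonal projection of `L²(ℂⁿ, dμ)` onto `F²`,
`(P F)(z) = ∫ F(w) K(z, w) dμ(w)`; used only for `F ∈ L²(ℂⁿ, dμ)`, where the integral
converges absolutely for every `z`. -/
def projection {n : ℕ} (F : (Fin n → ℂ) → ℂ) : (Fin n → ℂ) → ℂ :=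
  fun z => ∫ w, F w * kernel z w ∂(gaussian n)

/-- `D_c`: measurable functions `a` on `ℂⁿ` such that `a(z) exp(-c|z|²)` is essentially
bounded. -/
def growthClass (n : ℕ) (c : ℝ) : Set ((Fin n → ℂ) → ℂ) :=
  {a | Measurable a ∧ ∃ C : ℝ, ∀ᵐ z : Fin n → ℂ, ‖a z‖ * Real.exp (-c * normSq z) ≤ C}

/-- `Sym(ℂⁿ) = ⋂_{c > 0} D_c`. -/
def symbolClass (n : ℕ) : Set ((Fin n → ℂ) → ℂ) := ⋂ (c : ℝ) (_ : 0 < c), growthClass n c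

/-- The natural domain in `F²` of the (in general unbounded) Toeplitz operator `T_a = P M_a`:
all `h ∈ F²` with `a h ∈ L²(ℂⁿ, dμ)`. -/
def toeplitzDomain {n : ℕ} (a : (Fin n → ℂ) → ℂ) : Submodule ℂ ((Fin n → ℂ) → ℂ) where
  carrier := {h | h ∈ space n ∧ MemLp (fun w => a w * h w) 2 (gaussian n)}
  add_mem' {x y} hx hy := ⟨(space n).add_mem hx.1 hy.1, by
    refine (hx.2.add hy.2).ae_eq (Filter.Eventually.of_forall fun w => ?_)
    simp only [Pi.add_apply, mul_add]⟩
  zero_mem' := ⟨(space n).zero_mem, by simp⟩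
  smul_mem' c x hx := ⟨(space n).smul_mem c hx.1, by
    have := hx.2.const_smul c
    refine this.ae_eq (Filter.Eventually.of_forall fun w => ?_)
    simp only [Pi.smul_apply, smul_eq_mul]
    ring⟩

/-- The Toeplitz operator `T_a h = P (a h)`, for `h` in `toeplitzDomain a`. -/
def toeplitz {n : ℕ} (a h : (Fin n → ℂ) → ℂ) : (Fin n → ℂ) → ℂ :=
  projection fun w => a w * h w

/-- The natural domain of the operator product `T_a T_b`. -/
def productDomain {n : ℕ} (a b : (Fin n → ℂ) → ℂ) : Set ((Fin n → ℂ) → ℂ) :=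
  {h | h ∈ toeplitzDomain b ∧ toeplitz b h ∈ toeplitzDomain a}

/-- `T_a T_b = 0` on `F²`: the product of the two operators vanishes on its natural domain. -/
def ToeplitzProductEqZero {n : ℕ} (a b : (Fin n → ℂ) → ℂ) : Prop :=
  ∀ h ∈ productDomain a b, toeplitz a (toeplitz b h) = 0

end Fock

end

/-!
Applying `T_φ T_ψ = 0` to the kernel functions gives, for all `z` and `w`,
`f(z) u(z) + f(z) v̄(w) + ḡ(w) v̄(w) + B(u, g)(z, w) = 0`, where `B(u, g)` is the polarized Berezin
transform of `u ḡ`. Averaging it over `(z + ξ, w - ξ)` against the Gaussian measure inverts the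
Berezin transform and yields a dual identity, in which the mixed terms `f(z) v̄(w)` and
`u(z) ḡ(w)` have changed places.

If `g` and `v` are not constant, varying `w` in the two identities bounds `u` by Gaussian averages
of `f`, and both `f` and `f u` by Gaussian averages of `u`. So if `log⁺|u|` comes close to a bound
`X = ε |z|² + K` for both functions at some point, then `log⁺|f|` does so nearby, whereas
`log⁺|f| + log⁺|u|` never exceeds about `X`. The submean value property on discs rules this out,
so the bound for both functions can be lowered by the factor `9/10`; iterating, `u` is bounded,
hence constant by Liouville's theorem. As soon as one of `g`, `v`, `u` is constant, `B` is explicit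
and `(f(z) + ḡ(w)) (u(z) + v̄(w)) = 0` for all `z` and `w`, so one of the symbols vanishes.
-/

open Real Filter Asymptotics
open scoped Topology

namespace Fock

variable {n : ℕ}

theorem normSq_nonneg (z : Fin n → ℂ) : 0 ≤ normSq z :=
  Finset.sum_nonneg fun _ _ => sq_nonneg _

@[simp]
theorem normSq_zero : normSq (0 : Fin n → ℂ) = 0 := by simp [normSq]

@[simp]
theorem normSq_neg (z : Fin n → ℂ) : normSq (-z) = normSq z := by simp [normSq]

theorem normSq_smul (c : ℂ) (z : Fin n → ℂ) : normSq (c • z) = ‖c‖ ^ 2 * normSq z := by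
  simp [normSq, Finset.mul_sum, mul_pow]

@[fun_prop]
theorem continuous_normSq : Continuous (normSq : (Fin n → ℂ) → ℝ) := by
  unfold normSq
  fun_prop

theorem normSq_add_le (x y : Fin n → ℂ) {a : ℝ} (ha : 0 < a) :
    normSq (x + y) ≤ (1 + a) * normSq x + (1 + a⁻¹) * normSq y := by
  simp only [normSq, Finset.mul_sum, ← Finset.sum_add_distrib]
  refine Finset.sum_le_sum fun i _ => ?_
  have triangle : ‖x i + y i‖ ^ 2 ≤ (‖x i‖ + ‖y i‖) ^ 2 := by
    gcongr
    exact norm_add_le _ _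
  have young : 0 ≤ a⁻¹ * (a * ‖x i‖ - ‖y i‖) ^ 2 := by positivity
  have expand : a⁻¹ * (a * ‖x i‖ - ‖y i‖) ^ 2
      = a * ‖x i‖ ^ 2 - 2 * ‖x i‖ * ‖y i‖ + a⁻¹ * ‖y i‖ ^ 2 := by field_simp; ring
  rw [Pi.add_apply]
  linarith

theorem norm_kernel_le (z w : Fin n → ℂ) {a : ℝ} (ha : 0 < a) :
    ‖kernel z w‖ ≤ exp (a * normSq z + (4 * a)⁻¹ * normSq w) := by
  rw [kernel, Complex.norm_exp, exp_le_exp]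
  refine (Complex.re_le_norm _).trans ((norm_sum_le _ _).trans ?_)
  simp only [normSq, Finset.mul_sum, ← Finset.sum_add_distrib]
  refine Finset.sum_le_sum fun i _ => ?_
  rw [norm_mul, RCLike.norm_conj]
  have young : 0 ≤ (4 * a)⁻¹ * (2 * a * ‖z i‖ - ‖w i‖) ^ 2 := by positivity
  have expand : (4 * a)⁻¹ * (2 * a * ‖z i‖ - ‖w i‖) ^ 2
      = a * ‖z i‖ ^ 2 - ‖z i‖ * ‖w i‖ + (4 * a)⁻¹ * ‖w i‖ ^ 2 := by field_simp; ring
  linarith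

@[simp]
theorem conj_kernel (z w : Fin n → ℂ) : conj (kernel z w) = kernel w z := by
  simp only [kernel, ← Complex.exp_conj, map_sum, map_mul, Complex.conj_conj, mul_comm]

theorem kernel_self (z : Fin n → ℂ) : kernel z z = (exp (normSq z) : ℂ) := by
  simp [kernel, normSq, Complex.mul_conj, Complex.normSq_eq_norm_sq]

theorem kernel_ne_zero (z w : Fin n → ℂ) : kernel z w ≠ 0 := Complex.exp_ne_zero _

theorem kernel_add_left (z z' w : Fin n → ℂ) :
    kernel (z + z') w = kernel z w * kernel z' w := by
  simp [kernel, ← Complex.exp_add, add_mul, Finset.sum_add_distrib]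

theorem kernel_add_right (z w w' : Fin n → ℂ) :
    kernel z (w + w') = kernel z w * kernel z w' := by
  simp [kernel, ← Complex.exp_add, mul_add, Finset.sum_add_distrib]

theorem kernel_neg_right (z w : Fin n → ℂ) : kernel z (-w) = (kernel z w)⁻¹ := by
  simp [kernel, ← Complex.exp_neg]

@[fun_prop]
theorem continuous_kernel : Continuous (Function.uncurry (kernel (n := n))) := by
  unfold kernel Function.uncurry
  fun_prop

theorem differentiable_kernel (w : Fin n → ℂ) : Differentiable ℂ fun z => kernel z w := by
  unfold kernel
  fun_prop

/-- The continuous functions in `Sym(ℂⁿ)`. By continuity the growth condition holds at every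
point, not just almost everywhere. -/
structure SlowGrowth (h : (Fin n → ℂ) → ℂ) : Prop where
  continuous : Continuous h
  norm_le : ∀ c : ℝ, 0 < c → ∃ C : ℝ, ∀ z, ‖h z‖ ≤ C * exp (c * normSq z)

/-- The entire functions in `Sym(ℂⁿ)`. -/
structure EntireSymbol (h : (Fin n → ℂ) → ℂ) : Prop extends SlowGrowth h where
  differentiable : Differentiable ℂ h

section Symbols

variable {h k : (Fin n → ℂ) → ℂ}

namespace SlowGrowth

theorem of_mem_symbolClass (hh : h ∈ symbolClass n) (hc : Continuous h) : SlowGrowth h := by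
  refine ⟨hc, fun c c_pos => ?_⟩
  simp only [symbolClass, Set.mem_iInter] at hh
  obtain ⟨-, C, hC⟩ := hh c c_pos
  have bound : ∀ z, ‖h z‖ * exp (-c * normSq z) ≤ C := by
    have closed : IsClosed {z | ‖h z‖ * exp (-c * normSq z) ≤ C} :=
      isClosed_le (by fun_prop) continuous_const
    exact fun z => closed.closure_subset (Measure.dense_of_ae hC z)
  refine ⟨C, fun z => ?_⟩
  simpa only [neg_mul, exp_neg, ← div_eq_mul_inv, div_le_iff₀ (exp_pos _)] using bound z

theorem exists_nonneg (hh : SlowGrowth h) {c : ℝ} (hc : 0 < c) :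
    ∃ C : ℝ, 0 ≤ C ∧ ∀ z, ‖h z‖ ≤ C * exp (c * normSq z) := by
  obtain ⟨C, hC⟩ := hh.norm_le c hc
  exact ⟨C, by simpa using (norm_nonneg _).trans (hC 0), hC⟩

theorem const (a : ℂ) : SlowGrowth fun _ : Fin n → ℂ => a :=
  ⟨continuous_const, fun _ hc => ⟨‖a‖, fun z => le_mul_of_one_le_right (norm_nonneg _)
    (one_le_exp (mul_nonneg hc.le (normSq_nonneg z)))⟩⟩

theorem add (hh : SlowGrowth h) (hk : SlowGrowth k) : SlowGrowth fun z => h z + k z := by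
  refine ⟨hh.continuous.add hk.continuous, fun c hc => ?_⟩
  obtain ⟨C, hC⟩ := hh.norm_le c hc
  obtain ⟨D, hD⟩ := hk.norm_le c hc
  exact ⟨C + D, fun z => (norm_add_le _ _).trans (by rw [add_mul]; exact add_le_add (hC z) (hD z))⟩

theorem mul (hh : SlowGrowth h) (hk : SlowGrowth k) : SlowGrowth fun z => h z * k z := by
  refine ⟨hh.continuous.mul hk.continuous, fun c hc => ?_⟩
  obtain ⟨C, hC0, hC⟩ := hh.exists_nonneg (half_pos hc)
  obtain ⟨D, -, hD⟩ := hk.exists_nonneg (half_pos hc)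
  refine ⟨C * D, fun z => ?_⟩
  calc ‖h z * k z‖ ≤ (C * exp (c / 2 * normSq z)) * (D * exp (c / 2 * normSq z)) := by
        rw [norm_mul]
        exact mul_le_mul (hC z) (hD z) (norm_nonneg _) (by positivity)
    _ = C * D * exp (c * normSq z) := by
        rw [mul_mul_mul_comm, ← exp_add]
        ring_nf

theorem star (hh : SlowGrowth h) : SlowGrowth fun z => conj (h z) :=
  ⟨Complex.continuous_conj.comp hh.continuous, by simpa only [RCLike.norm_conj] using hh.norm_le⟩

theorem comp_neg (hh : SlowGrowth h) : SlowGrowth fun z => h (-z) :=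
  ⟨hh.continuous.comp continuous_neg, fun c hc =>
    (hh.norm_le c hc).imp fun _ hC z => (hC (-z)).trans_eq (by rw [normSq_neg])⟩

theorem comp_add_left (hh : SlowGrowth h) (a : Fin n → ℂ) : SlowGrowth fun z => h (a + z) := by
  refine ⟨hh.continuous.comp (continuous_const_add a), fun c hc => ?_⟩
  obtain ⟨C, hC0, hC⟩ := hh.exists_nonneg (half_pos hc)
  refine ⟨C * exp (c * normSq a), fun z => (hC _).trans ?_⟩
  rw [mul_assoc, ← exp_add]
  have young := normSq_add_le a z one_pos
  gcongr
  nlinarith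

theorem kernel_left (w : Fin n → ℂ) : SlowGrowth fun z => kernel z w :=
  ⟨(differentiable_kernel w).continuous, fun c hc => ⟨exp ((4 * c)⁻¹ * normSq w), fun z =>
    (norm_kernel_le z w hc).trans_eq (by rw [← exp_add, add_comm])⟩⟩

theorem kernel_right (z : Fin n → ℂ) : SlowGrowth fun w => kernel z w := by
  simpa only [conj_kernel] using (kernel_left z).star

theorem exists_norm_add_le (hh : SlowGrowth h) {c : ℝ} (hc : 0 < c) :
    ∃ C : ℝ, 0 ≤ C ∧ ∀ x y, ‖h (x + y)‖ ≤ C * exp (c * (normSq x + normSq y)) := by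
  obtain ⟨C, hC0, hC⟩ := hh.exists_nonneg (half_pos hc)
  refine ⟨C, hC0, fun x y => (hC _).trans ?_⟩
  have young := normSq_add_le x y one_pos
  refine mul_le_mul_of_nonneg_left (exp_le_exp.2 ?_) hC0
  nlinarith

end SlowGrowth

namespace EntireSymbol

theorem of_mem_symbolClass (hh : h ∈ symbolClass n) (hd : Differentiable ℂ h) :
    EntireSymbol h :=
  ⟨.of_mem_symbolClass hh hd.continuous, hd⟩

theorem const (a : ℂ) : EntireSymbol fun _ : Fin n → ℂ => a :=
  ⟨.const a, differentiable_const a⟩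

theorem add (hh : EntireSymbol h) (hk : EntireSymbol k) : EntireSymbol fun z => h z + k z :=
  ⟨hh.toSlowGrowth.add hk.toSlowGrowth, hh.differentiable.add hk.differentiable⟩

theorem mul (hh : EntireSymbol h) (hk : EntireSymbol k) : EntireSymbol fun z => h z * k z :=
  ⟨hh.toSlowGrowth.mul hk.toSlowGrowth, hh.differentiable.mul hk.differentiable⟩

theorem comp_neg (hh : EntireSymbol h) : EntireSymbol fun z => h (-z) :=
  ⟨hh.toSlowGrowth.comp_neg, hh.differentiable.comp differentiable_id.neg⟩

theorem comp_add_left (hh : EntireSymbol h) (a : Fin n → ℂ) : EntireSymbol fun z => h (a + z) :=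
  ⟨hh.toSlowGrowth.comp_add_left a, hh.differentiable.comp (differentiable_id.const_add a)⟩

theorem kernel_left (w : Fin n → ℂ) : EntireSymbol fun z => kernel z w :=
  ⟨.kernel_left w, differentiable_kernel w⟩

end EntireSymbol

end Symbols

/-- The density of the Gaussian measure with respect to Lebesgue measure. -/
noncomputable def density (z : Fin n → ℂ) : ℝ := (1 / π ^ n) * exp (-normSq z)

theorem density_nonneg (z : Fin n → ℂ) : 0 ≤ density z := by
  unfold density
  positivity

theorem measurable_ofReal_density :
    Measurable fun z : Fin n → ℂ => ENNReal.ofReal (density z) := by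
  unfold density
  fun_prop

theorem gaussian_eq (n : ℕ) :
    gaussian n = volume.withDensity fun z => ENNReal.ofReal (density z) := rfl

theorem integral_gaussian {E : Type*} [NormedAddCommGroup E] [NormedSpace ℝ E]
    (F : (Fin n → ℂ) → E) : ∫ z, F z ∂gaussian n = ∫ z, density z • F z := by
  rw [gaussian_eq, integral_withDensity_eq_integral_toReal_smul measurable_ofReal_density
    (.of_forall fun _ => ENNReal.ofReal_lt_top)]
  simp only [ENNReal.toReal_ofReal (density_nonneg _)]

theorem integrable_gaussian_iff {E : Type*} [NormedAddCommGroup E] [NormedSpace ℝ E]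
    {F : (Fin n → ℂ) → E} : Integrable F (gaussian n) ↔ Integrable fun z => density z • F z := by
  rw [gaussian_eq, integrable_withDensity_iff_integrable_smul' measurable_ofReal_density
    (.of_forall fun _ => ENNReal.ofReal_lt_top)]
  simp only [ENNReal.toReal_ofReal (density_nonneg _)]

theorem integrable_exp_neg_mul_normSq {c : ℝ} (hc : 0 < c) :
    Integrable fun z : Fin n → ℂ => exp (-c * normSq z) := by
  have one_dim : Integrable fun z : ℂ => exp (-c * ‖z‖ ^ 2) := by
    simpa [← Complex.ofReal_pow, ← Complex.ofReal_neg, ← Complex.ofReal_mul,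
      Complex.exp_ofReal_re] using
      (GaussianFourier.integrable_cexp_neg_mul_sq_norm_add (V := ℂ) (b := (c : ℂ))
        (by simpa using hc) 0 0).re
  refine (Integrable.fintype_prod (ι := Fin n) fun _ => one_dim).congr (.of_forall fun z => ?_)
  simp [normSq, ← exp_sum, Finset.mul_sum]

theorem integral_exp_neg_normSq (n : ℕ) : ∫ z : Fin n → ℂ, exp (-normSq z) = π ^ n := by
  have one_dim : ∫ z : ℂ, exp (-1 * ‖z‖ ^ 2) = π := by
    rw [GaussianFourier.integral_rexp_neg_mul_sq_norm one_pos]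
    simp
  calc ∫ z : Fin n → ℂ, exp (-normSq z) = ∫ z : Fin n → ℂ, ∏ i, exp (-1 * ‖z i‖ ^ 2) := by
        simp [normSq, ← exp_sum]
    _ = π ^ n := by
        rw [integral_fintype_prod_volume_eq_pow (fun z : ℂ => exp (-1 * ‖z‖ ^ 2)), one_dim,
          Fintype.card_fin]

theorem integrable_exp_mul_normSq {c : ℝ} (hc : c < 1) :
    Integrable (fun z => exp (c * normSq z)) (gaussian n) := by
  rw [integrable_gaussian_iff]
  refine ((integrable_exp_neg_mul_normSq (sub_pos.2 hc)).const_mul (1 / π ^ n)).congr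
    (.of_forall fun z => ?_)
  simp only [density, smul_eq_mul]
  rw [mul_assoc, ← exp_add]
  ring_nf

instance isProbabilityMeasure_gaussian (n : ℕ) : IsProbabilityMeasure (gaussian n) := by
  have : IsFiniteMeasure (gaussian n) := by
    simpa [integrable_const_iff] using integrable_exp_mul_normSq (n := n) (c := 0) one_pos
  have mass : (gaussian n).real Set.univ = 1 := by
    have := integral_gaussian fun _ : Fin n → ℂ => (1 : ℝ)
    simp only [density, smul_eq_mul, mul_one, integral_const_mul, integral_exp_neg_normSq,
      integral_const] at this
    rw [this]
    field_simp
  exact isProbabilityMeasure_iff_real.2 mass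

theorem SlowGrowth.integrable {h : (Fin n → ℂ) → ℂ} (hh : SlowGrowth h) :
    Integrable h (gaussian n) := by
  obtain ⟨C, hC⟩ := hh.norm_le (1 / 2) (by norm_num)
  exact ((integrable_exp_mul_normSq (by norm_num)).const_mul C).mono'
    hh.continuous.aestronglyMeasurable (.of_forall hC)

theorem SlowGrowth.memLp {h : (Fin n → ℂ) → ℂ} (hh : SlowGrowth h) : MemLp h 2 (gaussian n) := by
  rw [memLp_two_iff_integrable_sq_norm hh.continuous.aestronglyMeasurable]
  simpa [sq] using (hh.mul hh).integrable.norm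

theorem integral_mul_kernel_mul_kernel_self (F : (Fin n → ℂ) → ℂ) (a : Fin n → ℂ) :
    ∫ η, F η * (kernel a η * kernel η a) ∂gaussian n
      = kernel a a * ∫ ζ, F (a + ζ) ∂gaussian n := by
  have density_eq : ∀ z : Fin n → ℂ, (density z : ℂ) = (π ^ n : ℂ)⁻¹ * (kernel z z)⁻¹ := by
    simp [density, kernel_self, Complex.exp_neg]
  rw [integral_gaussian, integral_gaussian, ← integral_const_mul, ← integral_add_left_eq_self _ a]
  congr 1 with ζ
  simp only [Complex.real_smul, density_eq, kernel_add_left, kernel_add_right]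
  field_simp [kernel_ne_zero]

theorem integral_eq_integral_circleAverage {E G : Type*} [NormedAddCommGroup E] [NormedSpace ℂ E]
    [MeasurableSpace E] [BorelSpace E] [SecondCountableTopology E] [NormedAddCommGroup G]
    [NormedSpace ℝ G] [CompleteSpace G] {ν : Measure E} [SFinite ν]
    (hν : ∀ c : ℂ, ‖c‖ = 1 → MeasurePreserving (c • · : E → E) ν ν) {F : E → G}
    (hF : Continuous F) (hFi : Integrable F ν) :
    ∫ x, F x ∂ν = ∫ x, circleAverage (fun t => F (t • x)) 0 1 ∂ν := by
  have two_pi_nonneg : 0 ≤ 2 * π := by positivity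
  have rotate : ∀ θ : ℝ, MeasurePreserving (circleMap 0 1 θ • · : E → E) ν ν := fun θ =>
    hν _ (by simp)
  have embedding : ∀ θ : ℝ, MeasurableEmbedding (circleMap 0 1 θ • · : E → E) := fun θ =>
    (Homeomorph.smulOfNeZero (circleMap 0 1 θ)
      (circleMap_ne_center one_ne_zero)).measurableEmbedding
  have integrable_uncurry :
      Integrable (Function.uncurry fun (θ : ℝ) (x : E) => F (circleMap 0 1 θ • x))
        ((volume.restrict (Set.Ioc 0 (2 * π))).prod ν) := by
    rw [integrable_prod_iff (by unfold Function.uncurry; fun_prop)]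
    refine ⟨.of_forall fun θ => (rotate θ).integrable_comp_of_integrable hFi, ?_⟩
    simp only [Function.uncurry_apply_pair,
      fun θ => (rotate θ).integral_comp (embedding θ) fun x => ‖F x‖]
    exact integrable_const _
  have swap := integral_integral_swap integrable_uncurry
  simp only [fun θ => (rotate θ).integral_comp (embedding θ) F] at swap
  simp only [circleAverage_def, intervalIntegral.integral_of_le two_pi_nonneg]
  rw [integral_smul, ← swap, setIntegral_const, volume_real_Ioc_of_le two_pi_nonneg, sub_zero,
    smul_smul, inv_mul_cancel₀ (by positivity), one_smul]

theorem measurePreserving_mul_left {c : ℂ} (hc : ‖c‖ = 1) :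
    MeasurePreserving (c * · : ℂ → ℂ) :=
  (rotation ⟨c, mem_sphere_zero_iff_norm.2 hc⟩).measurePreserving

theorem measurePreserving_smul_gaussian {c : ℂ} (hc : ‖c‖ = 1) :
    MeasurePreserving (c • · : (Fin n → ℂ) → Fin n → ℂ) (gaussian n) (gaussian n) := by
  have lebesgue : MeasurePreserving (c • · : (Fin n → ℂ) → Fin n → ℂ) :=
    volume_preserving_pi (f := fun _ x => c * x) fun _ => measurePreserving_mul_left hc
  refine ⟨lebesgue.measurable, Measure.ext fun s hs => ?_⟩
  rw [Measure.map_apply lebesgue.measurable hs, gaussian_eq, withDensity_apply _ hs,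
    withDensity_apply _ (lebesgue.measurable hs),
    ← lebesgue.setLIntegral_comp_preimage hs measurable_ofReal_density]
  simp [density, normSq_smul, hc]

section EntireSymbol

variable {u g : (Fin n → ℂ) → ℂ}

theorem EntireSymbol.integral_eq (hu : EntireSymbol u) : ∫ z, u z ∂gaussian n = u 0 := by
  have mean_value : ∀ x : Fin n → ℂ, circleAverage (fun t : ℂ => u (t • x)) 0 1 = u 0 := fun x => by
    have : Differentiable ℂ fun t : ℂ => u (t • x) :=
      hu.differentiable.comp (differentiable_id.smul_const x)
    rw [this.diffContOnCl.circleAverage, zero_smul]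
  rw [integral_eq_integral_circleAverage (fun c hc => measurePreserving_smul_gaussian hc)
    hu.continuous hu.integrable]
  simp [mean_value]

theorem EntireSymbol.integral_mul_kernel (hu : EntireSymbol u) (z : Fin n → ℂ) :
    ∫ η, u η * kernel z η ∂gaussian n = u z := by
  have weyl := integral_mul_kernel_mul_kernel_self (fun η => u η * kernel η (-z)) z
  rw [((hu.mul (.kernel_left (-z))).comp_add_left z).integral_eq] at weyl
  simp only [kernel_neg_right, add_zero] at weyl
  convert weyl using 2
  · field_simp [kernel_ne_zero]
  · field_simp [kernel_ne_zero]

theorem EntireSymbol.integral_conj_mul_kernel (hu : EntireSymbol u) (z : Fin n → ℂ) :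
    ∫ η, conj (u η) * kernel η z ∂gaussian n = conj (u z) := by
  rw [← hu.integral_mul_kernel z, ← integral_conj]
  simp

theorem integrable_prod_mul_kernel {F : (Fin n → ℂ) × (Fin n → ℂ) → ℂ} (hF : Continuous F)
    {C c : ℝ} (hc : c < 1 / 2) (hFC : ∀ p, ‖F p‖ ≤ C * exp (c * (normSq p.1 + normSq p.2))) :
    Integrable (fun p => F p * kernel p.1 p.2) ((gaussian n).prod (gaussian n)) := by
  have gauss := integrable_exp_mul_normSq (n := n) (c := c + 1 / 2) (by linarith)
  refine ((gauss.const_mul C).mul_prod gauss).mono'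
    (hF.mul continuous_kernel).aestronglyMeasurable (.of_forall fun p => ?_)
  calc ‖F p * kernel p.1 p.2‖
      ≤ C * exp (c * (normSq p.1 + normSq p.2))
          * exp (1 / 2 * normSq p.1 + (4 * (1 / 2))⁻¹ * normSq p.2) := by
        rw [norm_mul]
        exact mul_le_mul (hFC p) (norm_kernel_le _ _ one_half_pos) (norm_nonneg _)
          ((norm_nonneg _).trans (hFC p))
    _ = C * exp ((c + 1 / 2) * normSq p.1) * exp ((c + 1 / 2) * normSq p.2) := by
        rw [mul_assoc, mul_assoc, ← exp_add, ← exp_add]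
        ring_nf

/-- The adjoint of translation by `a` is multiplication by the kernel function at `a`. -/
theorem integral_add_mul_conj (hu : EntireSymbol u) (hg : EntireSymbol g) (a : Fin n → ℂ) :
    ∫ ζ, u (a + ζ) * conj (g ζ) ∂gaussian n
      = ∫ η, u η * kernel a η * conj (g η) ∂gaussian n := by
  have integrable : Integrable (fun p : (Fin n → ℂ) × (Fin n → ℂ) =>
      conj (g p.1) * (u p.2 * kernel a p.2) * kernel p.1 p.2)
      ((gaussian n).prod (gaussian n)) := by
    have ug := hu.toSlowGrowth.mul (.kernel_right a)
    obtain ⟨C, hC0, hC⟩ := hg.exists_nonneg (c := 1 / 4) (by norm_num)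
    obtain ⟨D, -, hD⟩ := ug.exists_nonneg (c := 1 / 4) (by norm_num)
    refine integrable_prod_mul_kernel (C := C * D) (c := 1 / 4)
      ((hg.star.continuous.comp continuous_fst).mul (ug.continuous.comp continuous_snd))
      (by norm_num) fun p => ?_
    rw [norm_mul, RCLike.norm_conj, mul_add, exp_add, mul_mul_mul_comm]
    exact mul_le_mul (hC _) (hD _) (norm_nonneg _) (by positivity)
  calc ∫ ζ, u (a + ζ) * conj (g ζ) ∂gaussian n
      = ∫ ζ, ∫ η, conj (g ζ) * (u η * kernel a η) * kernel ζ η ∂gaussian n ∂gaussian n := by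
        congr 1 with ζ
        simp only [mul_assoc, ← kernel_add_left, integral_const_mul, hu.integral_mul_kernel]
        rw [mul_comm]
    _ = ∫ η, ∫ ζ, conj (g ζ) * (u η * kernel a η) * kernel ζ η ∂gaussian n ∂gaussian n :=
        integral_integral_swap integrable
    _ = ∫ η, u η * kernel a η * conj (g η) ∂gaussian n := by
        congr 1 with η
        simp only [mul_right_comm _ (u η * kernel a η), integral_mul_const,
          hg.integral_conj_mul_kernel]
        rw [mul_comm]

/-- The polarized Berezin transform of `u ḡ`; on the diagonal `z = w` it is the Gaussian average
of `u ḡ` around `z`. -/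
noncomputable def berezin (u g : (Fin n → ℂ) → ℂ) (z w : Fin n → ℂ) : ℂ :=
  ∫ ζ, u (z + ζ) * conj (g (w + ζ)) ∂gaussian n

theorem integral_mul_conj_mul_kernel (hu : EntireSymbol u) (hg : EntireSymbol g)
    (z w : Fin n → ℂ) :
    ∫ η, u η * conj (g η) * (kernel z η * kernel η w) ∂gaussian n
      = berezin u g z w * kernel z w := by
  have split : ∀ η, kernel z η = kernel (z - w) η * kernel w η := fun η => by
    rw [← kernel_add_left, sub_add_cancel]
  calc ∫ η, u η * conj (g η) * (kernel z η * kernel η w) ∂gaussian n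
      = ∫ η, u η * kernel (z - w) η * conj (g η) * (kernel w η * kernel η w) ∂gaussian n := by
        congr 1 with η
        rw [split]
        ring
    _ = kernel z w * ∫ ζ, u (w + ζ) * kernel (z - w) ζ * conj (g (w + ζ)) ∂gaussian n := by
        rw [integral_mul_kernel_mul_kernel_self, split w, mul_comm (kernel (z - w) w), mul_assoc,
          ← integral_const_mul (kernel (z - w) w)]
        congr 2 with ζ
        rw [kernel_add_right]
        ring
    _ = berezin u g z w * kernel z w := by
        rw [← integral_add_mul_conj (hu.comp_add_left w) (hg.comp_add_left w), mul_comm, berezin]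
        simp only [← add_assoc, add_sub_cancel]

theorem integrable_mul_conj_mul_kernel (hu : EntireSymbol u) (hg : EntireSymbol g)
    (z w : Fin n → ℂ) :
    Integrable (fun p : (Fin n → ℂ) × (Fin n → ℂ) =>
      u (z + p.2) * conj (g (w - p.1 + p.2)) * kernel p.1 p.2)
      ((gaussian n).prod (gaussian n)) := by
  obtain ⟨C, hC0, hC⟩ := (hu.comp_add_left z).exists_nonneg (c := 1 / 8) (by norm_num)
  obtain ⟨D, hD0, hD⟩ := (hg.comp_add_left w).exists_norm_add_le (c := 1 / 8) (by norm_num)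
  have continuous : Continuous fun p : (Fin n → ℂ) × (Fin n → ℂ) =>
      u (z + p.2) * conj (g (w - p.1 + p.2)) :=
    (hu.continuous.comp (by fun_prop)).mul (hg.star.continuous.comp (by fun_prop))
  refine integrable_prod_mul_kernel (C := C * D) (c := 1 / 4) continuous (by norm_num)
    fun ⟨ξ, η⟩ => ?_
  calc ‖u (z + η) * conj (g (w - ξ + η))‖
      ≤ C * exp (1 / 8 * normSq η) * (D * exp (1 / 8 * (normSq (-ξ) + normSq η))) := by
        rw [norm_mul, RCLike.norm_conj, sub_eq_add_neg, add_assoc]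
        exact mul_le_mul (hC η) (hD (-ξ) η) (norm_nonneg _) (by positivity)
    _ ≤ C * D * exp (1 / 4 * (normSq ξ + normSq η)) := by
        rw [normSq_neg, mul_mul_mul_comm, ← exp_add]
        have := normSq_nonneg ξ
        gcongr
        linarith

theorem berezin_add_sub (hu : EntireSymbol u) (hg : EntireSymbol g) (z w ξ : Fin n → ℂ) :
    berezin u g (z + ξ) (w - ξ)
      = ∫ η, u (z + η) * conj (g (w - ξ + η)) * kernel ξ η ∂gaussian n := by
  have adjoint := integral_add_mul_conj (hu.comp_add_left z) (hg.comp_add_left (w - ξ)) ξ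
  simp only [← add_assoc, mul_right_comm _ (kernel ξ _)] at adjoint
  exact adjoint

/-- Gaussian averaging along the antidiagonal inverts the Berezin transform. -/
theorem integral_berezin_add_sub (hu : EntireSymbol u) (hg : EntireSymbol g)
    (z w : Fin n → ℂ) :
    ∫ ξ, berezin u g (z + ξ) (w - ξ) ∂gaussian n = u z * conj (g w) := by
  have reflect : ∀ η : Fin n → ℂ,
      ∫ ξ, conj (g (w - ξ + η)) * kernel ξ η ∂gaussian n = conj (g w) := fun η => by
    have := ((hg.comp_add_left (w + η)).comp_neg).integral_conj_mul_kernel η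
    simpa only [← sub_eq_add_neg, add_sub_right_comm, sub_add_cancel] using this
  calc ∫ ξ, berezin u g (z + ξ) (w - ξ) ∂gaussian n
      = ∫ η, ∫ ξ, u (z + η) * conj (g (w - ξ + η)) * kernel ξ η ∂gaussian n ∂gaussian n := by
        simp only [berezin_add_sub hu hg]
        exact integral_integral_swap (integrable_mul_conj_mul_kernel hu hg z w)
    _ = u z * conj (g w) := by
        simp only [mul_assoc, integral_const_mul, reflect, integral_mul_const,
          (hu.comp_add_left z).integral_eq, add_zero]

end EntireSymbol

section ToeplitzProduct

variable {f g u v h : (Fin n → ℂ) → ℂ}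

theorem berezin_const_left (hg : EntireSymbol g) (c : ℂ) (z w : Fin n → ℂ) :
    berezin (fun _ => c) g z w = c * conj (g w) := by
  rw [berezin, integral_const_mul, integral_conj, (hg.comp_add_left w).integral_eq, add_zero]

theorem berezin_const_right (hu : EntireSymbol u) (c : ℂ) (z w : Fin n → ℂ) :
    berezin u (fun _ => c) z w = u z * conj c := by
  rw [berezin, integral_mul_const, (hu.comp_add_left z).integral_eq, add_zero]

theorem SlowGrowth.add_mul_conj_add (hu : SlowGrowth u) (hg : SlowGrowth g) (z w : Fin n → ℂ) :
    SlowGrowth fun ζ => u (z + ζ) * conj (g (w + ζ)) :=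
  (hu.comp_add_left z).mul (hg.comp_add_left w).star

theorem berezin_add_left (hu : SlowGrowth u) (hh : SlowGrowth h) (hg : SlowGrowth g)
    (z w : Fin n → ℂ) :
    berezin (fun z => u z + h z) g z w = berezin u g z w + berezin h g z w := by
  simp only [berezin, add_mul]
  exact integral_add (hu.add_mul_conj_add hg z w).integrable (hh.add_mul_conj_add hg z w).integrable

theorem toeplitz_mul_kernel (hf : EntireSymbol f) (hg : EntireSymbol g) (hh : EntireSymbol h)
    (z w : Fin n → ℂ) :
    toeplitz (fun z => f z + conj (g z)) (fun z => h z * kernel z w) z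
      = (f z * h z + berezin h g z w) * kernel z w := by
  have fhk := (hf.mul hh).mul (.kernel_left w)
  have hgk := (hh.toSlowGrowth.mul hg.star).mul ((SlowGrowth.kernel_right z).mul (.kernel_left w))
  calc toeplitz (fun z => f z + conj (g z)) (fun z => h z * kernel z w) z
      = ∫ η, f η * h η * kernel η w * kernel z η
          + h η * conj (g η) * (kernel z η * kernel η w) ∂gaussian n := by
        unfold toeplitz projection
        congr 1 with η
        ring
    _ = f z * h z * kernel z w + berezin h g z w * kernel z w := by
        rw [integral_add (fhk.toSlowGrowth.mul (.kernel_right z)).integrable hgk.integrable,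
          fhk.integral_mul_kernel, integral_mul_conj_mul_kernel hh hg]
    _ = (f z * h z + berezin h g z w) * kernel z w := by ring

theorem toeplitz_kernel (hu : EntireSymbol u) (hv : EntireSymbol v) (w : Fin n → ℂ) :
    toeplitz (fun z => u z + conj (v z)) (fun z => kernel z w)
      = fun z => (u z + conj (v w)) * kernel z w := by
  funext z
  simpa [berezin_const_left hv] using toeplitz_mul_kernel hu hv (.const 1) z w

theorem EntireSymbol.mem_space (hh : EntireSymbol h) : h ∈ space n :=
  ⟨hh.differentiable, hh.memLp⟩

theorem EntireSymbol.mem_toeplitzDomain (hh : EntireSymbol h) (hf : SlowGrowth f) :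
    h ∈ toeplitzDomain f :=
  ⟨hh.mem_space, (hf.mul hh.toSlowGrowth).memLp⟩

/-- The left side times `K(z, w)` is `(T_φ T_ψ K_w)(z)`. -/
theorem ToeplitzProductEqZero.berezin_identity (hf : EntireSymbol f) (hg : EntireSymbol g)
    (hu : EntireSymbol u) (hv : EntireSymbol v)
    (hT : ToeplitzProductEqZero (fun z => f z + conj (g z)) (fun z => u z + conj (v z)))
    (z w : Fin n → ℂ) :
    f z * u z + f z * conj (v w) + conj (g w) * conj (v w) + berezin u g z w = 0 := by
  have huv := hu.add (.const (conj (v w)))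
  have mem : (fun z => kernel z w) ∈
      productDomain (fun z => f z + conj (g z)) (fun z => u z + conj (v z)) := by
    refine ⟨(EntireSymbol.kernel_left w).mem_toeplitzDomain (hu.toSlowGrowth.add hv.star), ?_⟩
    rw [toeplitz_kernel hu hv]
    exact (huv.mul (.kernel_left w)).mem_toeplitzDomain (hf.toSlowGrowth.add hg.star)
  have zero := congrFun (hT _ mem) z
  rw [toeplitz_kernel hu hv, toeplitz_mul_kernel hf hg huv, Pi.zero_apply, mul_eq_zero,
    or_iff_left (kernel_ne_zero z w),
    berezin_add_left hu.toSlowGrowth (.const _) hg.toSlowGrowth, berezin_const_left hg] at zero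
  linear_combination zero

theorem berezin_identity_dual (hf : EntireSymbol f) (hg : EntireSymbol g)
    (hu : EntireSymbol u) (hv : EntireSymbol v)
    (hB : ∀ z w,
      f z * u z + f z * conj (v w) + conj (g w) * conj (v w) + berezin u g z w = 0)
    (z w : Fin n → ℂ) :
    f z * u z + u z * conj (g w) + conj (g w) * conj (v w)
      + berezin f (fun ζ => v (-ζ)) z (-w) = 0 := by
  have average := integral_berezin_add_sub hu hg z w
  have solved : ∀ ξ, berezin u g (z + ξ) (w - ξ)
      = -(f (z + ξ) * u (z + ξ) + f (z + ξ) * conj (v (-(-w + ξ)))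
        + conj (g (-(-w + ξ)) * v (-(-w + ξ)))) := fun ξ => by
    rw [show -(-w + ξ) = w - ξ by abel, map_mul]
    linear_combination hB (z + ξ) (w - ξ)
  have fu := (hf.mul hu).comp_add_left z
  have gv := (hg.mul hv).comp_neg.comp_add_left (-w)
  have fv := hf.toSlowGrowth.add_mul_conj_add hv.comp_neg.toSlowGrowth z (-w)
  simp only [solved] at average
  rw [integral_neg, integral_add (fu.toSlowGrowth.add fv).integrable gv.star.integrable,
    integral_add fu.integrable fv.integrable, fu.integral_eq, integral_conj, gv.integral_eq,
    map_mul, add_zero, add_zero, neg_neg] at average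
  rw [berezin]
  linear_combination -average

end ToeplitzProduct

section PosLog

theorem posLog_add_posLog_le_max (x y : ℝ) :
    log⁺ x + log⁺ y ≤ max (max (log⁺ x) (log⁺ y)) (log⁺ (x * y)) := by
  rcases le_total |x| 1 with hx | hx
  · simp [(posLog_eq_zero_iff x).2 hx]
  rcases le_total |y| 1 with hy | hy
  · simp [(posLog_eq_zero_iff y).2 hy]
  refine le_max_of_le_right (le_of_eq ?_)
  have hxy : 1 ≤ |x * y| := by
    rw [abs_mul]
    exact one_le_mul_of_one_le_of_one_le hx hy
  rw [posLog_eq_log hx, posLog_eq_log hy, posLog_eq_log hxy,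
    log_mul (abs_pos.1 (one_pos.trans_le hx)) (abs_pos.1 (one_pos.trans_le hy))]

theorem le_exp_posLog (x : ℝ) : x ≤ exp (log⁺ x) :=
  (le_exp_log x).trans (exp_le_exp.2 (le_max_right _ _))

theorem posLog_exp {x : ℝ} (hx : 0 ≤ x) : log⁺ (exp x) = x := by
  rw [posLog_apply, log_exp, max_eq_right hx]

variable {a b : ℂ → ℂ}

theorem continuous_posLog_norm {X : Type*} [TopologicalSpace X] {a : X → ℂ} (ha : Continuous a) :
    Continuous fun t => log⁺ ‖a t‖ :=
  continuous_posLog.comp ha.norm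

theorem posLog_norm_le_circleAverage (ha : Differentiable ℂ a) (c : ℂ) {R : ℝ} (hR : 0 < R) :
    log⁺ ‖a c‖ ≤ circleAverage (fun t => log⁺ ‖a t‖) c R := by
  refine max_le (circleAverage_nonneg_of_nonneg fun _ _ => posLog_nonneg) ?_
  by_cases hc : a c = 0
  · rw [hc, norm_zero, log_zero]
    exact circleAverage_nonneg_of_nonneg fun _ _ => posLog_nonneg
  have analytic : AnalyticOnNhd ℂ a (Metric.closedBall c |R|) := fun z _ => ha.analyticAt z
  have zeros_nonneg : 0 ≤ ∑ᶠ t : ℂ,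
      (MeromorphicOn.divisor a (Metric.closedBall c |R|) t : ℝ) * log (R * ‖c - t‖⁻¹) := by
    refine finsum_nonneg fun t => ?_
    by_cases ht : t ∈ Metric.closedBall c |R|
    · refine mul_nonneg (mod_cast MeromorphicOn.AnalyticOnNhd.divisor_nonneg analytic t) ?_
      rcases (norm_nonneg (c - t)).eq_or_lt with h0 | hpos
      · simp [← h0]
      · rw [Metric.mem_closedBall', dist_eq_norm, abs_of_pos hR] at ht
        exact log_nonneg ((one_le_div hpos).2 ht)
    · simp [Function.locallyFinsuppWithin.apply_eq_zero_of_notMem _ ht]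
  calc log ‖a c‖ ≤ circleAverage (fun t => log ‖a t‖) c R := by
        rw [analytic.circleAverage_log_norm hR.ne' hc]
        exact le_add_of_nonneg_left zeros_nonneg
    _ ≤ circleAverage (fun t => log⁺ ‖a t‖) c R :=
        circleAverage_mono
          (MeromorphicOn.circleIntegrable_log_norm fun t _ => (ha.analyticAt t).meromorphicAt)
          ((continuous_posLog_norm ha.continuous).continuousOn.circleIntegrable hR.le)
          fun _ _ => le_max_right _ _

theorem integrableOn_ball {F : ℂ → ℝ} (hF : Continuous F) (c : ℂ) (R : ℝ) :
    IntegrableOn F (Metric.ball c R) :=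
  (hF.continuousOn.integrableOn_compact (isCompact_closedBall c R)).mono_set
    Metric.ball_subset_closedBall

theorem setIntegral_ball_zero_eq_circleAverage {F : ℂ → ℝ} (hF : Continuous F) (R : ℝ) :
    ∫ t in Metric.ball 0 R, F t
      = ∫ t in Metric.ball 0 R, circleAverage (fun s => F (s • t)) 0 1 := by
  refine integral_eq_integral_circleAverage (fun s hs => ?_) hF (integrableOn_ball hF 0 R)
  have invariant : (s * · : ℂ → ℂ) ⁻¹' Metric.ball 0 R = Metric.ball 0 R := by
    ext
    simp [hs]
  simpa only [smul_eq_mul, invariant] using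
    (measurePreserving_mul_left hs).restrict_preimage (s := Metric.ball 0 R) measurableSet_ball

theorem posLog_norm_le_setIntegral_ball_zero (ha : Differentiable ℂ a) (R : ℝ) :
    volume.real (Metric.ball (0 : ℂ) R) * log⁺ ‖a 0‖ ≤ ∫ t in Metric.ball 0 R, log⁺ ‖a t‖ := by
  have continuous := continuous_posLog_norm ha.continuous
  have continuous_average :
      Continuous fun t => circleAverage (fun s => log⁺ ‖a (s • t)‖) 0 1 := by
    simp only [circleAverage_def]
    refine Continuous.const_smul ?_ (2 * π)⁻¹
    refine intervalIntegral.continuous_parametric_intervalIntegral_of_continuous' ?_ _ _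
    exact continuous.comp (by fun_prop)
  rw [setIntegral_ball_zero_eq_circleAverage continuous, ← smul_eq_mul, ← setIntegral_const]
  refine setIntegral_mono_on (integrableOn_ball continuous_const 0 R)
    (integrableOn_ball continuous_average 0 R) measurableSet_ball fun t _ => ?_
  simpa using
    posLog_norm_le_circleAverage (a := fun s => a (s • t)) (by fun_prop) 0 one_pos

theorem setIntegral_ball_sub_posLog_le (ha : Differentiable ℂ a) (c : ℂ) (R A : ℝ) :
    ∫ t in Metric.ball c R, (A - log⁺ ‖a t‖)
      ≤ volume.real (Metric.ball c R) * (A - log⁺ ‖a c‖) := by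
  have shift : ∫ t in Metric.ball c R, log⁺ ‖a t‖ = ∫ t in Metric.ball 0 R, log⁺ ‖a (c + t)‖ := by
    rw [← (measurePreserving_add_left volume c).setIntegral_preimage_emb
      (measurableEmbedding_addLeft c), preimage_add_ball, sub_self]
  have submean := posLog_norm_le_setIntegral_ball_zero (a := fun t => a (c + t)) (by fun_prop) R
  have volume_eq : volume.real (Metric.ball (0 : ℂ) R) = volume.real (Metric.ball c R) :=
    (Measure.addHaar_real_ball_center volume c R).symm
  rw [add_zero, volume_eq] at submean
  rw [integral_sub (integrableOn_ball continuous_const c R)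
    (integrableOn_ball (continuous_posLog_norm ha.continuous) c R), shift, setIntegral_const,
    smul_eq_mul]
  linarith

theorem volume_real_ball (c : ℂ) {r : ℝ} (hr : 0 ≤ r) :
    volume.real (Metric.ball c r) = π * r ^ 2 := by
  rw [measureReal_def, Complex.volume_ball]
  simp [hr, mul_comm]

/-- On the smaller disc the nonnegative deficits `A - log⁺|a|` and `A - log⁺|b|` add up to at
least `2 A - P`, while their averages are at most their values at the centres. -/
theorem posLog_two_discs (ha : Differentiable ℂ a) (hb : Differentiable ℂ b) {c d : ℂ}
    {R r A P : ℝ} (hR : 0 ≤ R) (hr : 0 ≤ r) (hball : Metric.ball d r ⊆ Metric.ball c R)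
    (hA : ∀ t ∈ Metric.ball c R, log⁺ ‖a t‖ ≤ A)
    (hP : ∀ t ∈ Metric.ball d r, log⁺ ‖a t‖ + log⁺ ‖b t‖ ≤ P) :
    r ^ 2 * (2 * A - P) ≤ R ^ 2 * (A - log⁺ ‖a c‖) + r ^ 2 * (A - log⁺ ‖b d‖) := by
  have integrable : ∀ {k : ℂ → ℂ}, Differentiable ℂ k → ∀ c R,
      IntegrableOn (fun t => A - log⁺ ‖k t‖) (Metric.ball c R) := fun hk =>
    integrableOn_ball (continuous_const.sub (continuous_posLog_norm hk.continuous))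
  refine le_of_mul_le_mul_left ?_ pi_pos
  rw [mul_add, ← mul_assoc, ← mul_assoc, ← mul_assoc, ← volume_real_ball d hr,
    ← volume_real_ball c hR]
  calc volume.real (Metric.ball d r) * (2 * A - P)
      = ∫ _ in Metric.ball d r, (2 * A - P) := by rw [setIntegral_const, smul_eq_mul]
    _ ≤ ∫ t in Metric.ball d r, ((A - log⁺ ‖a t‖) + (A - log⁺ ‖b t‖)) := by
        refine setIntegral_mono_on (integrableOn_ball continuous_const d r)
          ((integrable ha d r).add (integrable hb d r)) measurableSet_ball fun t ht => ?_
        linarith [hP t ht]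
    _ = (∫ t in Metric.ball d r, (A - log⁺ ‖a t‖)) + ∫ t in Metric.ball d r, (A - log⁺ ‖b t‖) :=
        integral_add (integrable ha d r) (integrable hb d r)
    _ ≤ (∫ t in Metric.ball c R, (A - log⁺ ‖a t‖)) + ∫ t in Metric.ball d r, (A - log⁺ ‖b t‖) := by
        gcongr ?_ + _
        refine setIntegral_mono_set (integrable ha c R) ?_ hball.eventuallyLE
        exact ae_restrict_of_forall_mem measurableSet_ball fun t ht => sub_nonneg.2 (hA t ht)
    _ ≤ _ := add_le_add (setIntegral_ball_sub_posLog_le ha c R A)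
        (setIntegral_ball_sub_posLog_le hb d r A)

end PosLog

section LogEnvelope

variable {h k : (Fin n → ℂ) → ℂ}

theorem SlowGrowth.exists_posLog_norm_le (hh : SlowGrowth h) {c : ℝ} (hc : 0 < c) :
    ∃ K : ℝ, 0 ≤ K ∧ ∀ z, log⁺ ‖h z‖ ≤ c * normSq z + K := by
  obtain ⟨C, -, hC⟩ := hh.exists_nonneg hc
  refine ⟨log⁺ C, posLog_nonneg, fun z => ?_⟩
  have exponent_nonneg : 0 ≤ c * normSq z := mul_nonneg hc.le (normSq_nonneg z)
  calc log⁺ ‖h z‖ ≤ log⁺ (C * exp (c * normSq z)) := posLog_le_posLog (norm_nonneg _) (hC z)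
    _ ≤ log⁺ C + log⁺ (exp (c * normSq z)) := posLog_mul
    _ = c * normSq z + log⁺ C := by
        rw [posLog_exp exponent_nonneg, add_comm]

/-- The least `Λ` such that `log⁺ |h(z + ζ)| ≤ Λ + |ζ|² / 4` for all `ζ`. Its exponential dominates
the Gaussian averages of `h` around `z` against functions in `Sym(ℂⁿ)`. The supremum is finite for
`h` of slow growth. -/
noncomputable def logEnvelope (h : (Fin n → ℂ) → ℂ) (z : Fin n → ℂ) : ℝ :=
  ⨆ ζ, (log⁺ ‖h (z + ζ)‖ - normSq ζ / 4)

theorem SlowGrowth.posLog_norm_add_le (hh : SlowGrowth h) (z ζ : Fin n → ℂ) :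
    log⁺ ‖h (z + ζ)‖ ≤ logEnvelope h z + normSq ζ / 4 := by
  obtain ⟨K, -, hK⟩ := (hh.comp_add_left z).exists_posLog_norm_le (c := 1 / 4) (by norm_num)
  have bdd : BddAbove (Set.range fun ζ => log⁺ ‖h (z + ζ)‖ - normSq ζ / 4) :=
    ⟨K, Set.forall_mem_range.2 fun η => by linarith [hK η]⟩
  exact sub_le_iff_le_add.1 (le_ciSup bdd ζ)

theorem SlowGrowth.posLog_norm_le_logEnvelope (hh : SlowGrowth h) (z : Fin n → ℂ) :
    log⁺ ‖h z‖ ≤ logEnvelope h z := by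
  simpa using hh.posLog_norm_add_le z 0

theorem SlowGrowth.isBigO_const (hh : SlowGrowth h) (c : ℂ) :
    (fun _ => c) =O[⊤] fun z => exp (logEnvelope h z) := by
  refine isBigO_top.2 ⟨‖c‖, fun z => le_mul_of_one_le_right (norm_nonneg c) ?_⟩
  rw [norm_of_nonneg (exp_pos _).le, one_le_exp_iff]
  exact posLog_nonneg.trans (hh.posLog_norm_le_logEnvelope z)

theorem SlowGrowth.isBigO_berezin (hh : SlowGrowth h) (hk : SlowGrowth k) (w : Fin n → ℂ) :
    (fun z => berezin h k z w) =O[⊤] fun z => exp (logEnvelope h z) := by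
  obtain ⟨C, -, hC⟩ := (hk.comp_add_left w).exists_nonneg (c := 1 / 4) (by norm_num)
  have gauss := (integrable_exp_mul_normSq (n := n) (c := 1 / 2) (by norm_num)).const_mul C
  refine isBigO_top.2
    ⟨∫ ζ, C * exp (1 / 2 * normSq ζ) ∂gaussian n, fun z => ?_⟩
  rw [norm_of_nonneg (exp_pos _).le, ← integral_mul_const]
  refine norm_integral_le_of_norm_le (gauss.mul_const _) (.of_forall fun ζ => ?_)
  calc ‖h (z + ζ) * conj (k (w + ζ))‖
      ≤ exp (logEnvelope h z + normSq ζ / 4) * (C * exp (1 / 4 * normSq ζ)) := by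
        rw [norm_mul, RCLike.norm_conj]
        refine mul_le_mul ((le_exp_posLog _).trans ?_) (hC ζ) (norm_nonneg _) (exp_pos _).le
        exact exp_le_exp.2 (hh.posLog_norm_add_le z ζ)
    _ = C * exp (1 / 2 * normSq ζ) * exp (logEnvelope h z) := by
        rw [mul_left_comm, mul_assoc, ← exp_add, ← exp_add]
        ring_nf

theorem SlowGrowth.exists_posLog_le_of_isBigO (hh : SlowGrowth h)
    (hk : k =O[⊤] fun z => exp (logEnvelope h z)) :
    ∃ C : ℝ, 0 ≤ C ∧ ∀ z, log⁺ ‖k z‖ ≤ logEnvelope h z + C := by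
  obtain ⟨C, hC⟩ := isBigO_top.1 hk
  refine ⟨log⁺ C, posLog_nonneg, fun z => ?_⟩
  have envelope_nonneg := posLog_nonneg.trans (hh.posLog_norm_le_logEnvelope z)
  calc log⁺ ‖k z‖ ≤ log⁺ (C * ‖exp (logEnvelope h z)‖) := posLog_le_posLog (norm_nonneg _) (hC z)
    _ ≤ log⁺ C + log⁺ ‖exp (logEnvelope h z)‖ := posLog_mul
    _ = logEnvelope h z + log⁺ C := by
        rw [norm_of_nonneg (exp_pos _).le, posLog_exp envelope_nonneg, add_comm]

theorem isBigO_of_add_mul_add_eq {α β : Type*} {a p : α → ℂ} {c q : β → ℂ} {r : α → β → ℂ}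
    {E : α → ℝ} {l : Filter α} (h : ∀ z w, p z + a z * c w + q w = r z w)
    (hE : ∀ C : ℂ, (fun _ => C) =O[l] E) (hr : ∀ w, (r · w) =O[l] E) {w₁ w₂ : β}
    (hc : c w₁ ≠ c w₂) : a =O[l] E := by
  have solved : a = fun z => (c w₁ - c w₂)⁻¹ * (r z w₁ - r z w₂ - (q w₁ - q w₂)) := by
    funext z
    rw [eq_inv_mul_iff_mul_eq₀ (sub_ne_zero.2 hc)]
    linear_combination h z w₁ - h z w₂
  rw [solved]
  exact (((hr w₁).sub (hr w₂)).sub (hE _)).const_mul_left _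

end LogEnvelope

section GrowthImprovement

variable {f u h : (Fin n → ℂ) → ℂ} {ε K C : ℝ}

theorem mul_normSq_add_add_le (hε : 0 ≤ ε) (hK : 0 ≤ K) {a : ℝ} (ha : 0 < a) (x y : Fin n → ℂ) :
    ε * normSq (x + y) + K ≤ (1 + a) * (ε * normSq x + K) + (1 + a⁻¹) * ε * normSq y := by
  have young := mul_le_mul_of_nonneg_left (normSq_add_le x y ha) hε
  have slack := mul_nonneg ha.le hK
  linarith

theorem logEnvelope_le (hε : 0 ≤ ε) (hK : 0 ≤ K) (hh : ∀ z, log⁺ ‖h z‖ ≤ ε * normSq z + K)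
    {a : ℝ} (ha : 0 < a) (hεa : (1 + a⁻¹) * ε ≤ 1 / 4) (z : Fin n → ℂ) :
    logEnvelope h z ≤ (1 + a) * (ε * normSq z + K) := by
  refine ciSup_le fun ζ => ?_
  have absorb := mul_le_mul_of_nonneg_right hεa (normSq_nonneg ζ)
  linarith [hh (z + ζ), mul_normSq_add_add_le hε hK ha z ζ]

theorem growth_along_line_le (hε : 0 ≤ ε) (hε' : ε ≤ 1 / 10 ^ 6) (hK : 0 ≤ K) {z ζ : Fin n → ℂ}
    (hζ : normSq ζ ≤ 5 * (ε * normSq z + K)) {t : ℂ} (ht : ‖t‖ ≤ 3) :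
    ε * normSq (z + t • ζ) + K ≤ 21 / 20 * (ε * normSq z + K) := by
  have young := mul_normSq_add_add_le hε hK (a := 1 / 50) (by norm_num) z (t • ζ)
  have shift : ε * normSq (t • ζ) ≤ 1 / 10 ^ 6 * (3 ^ 2 * (5 * (ε * normSq z + K))) := by
    rw [normSq_smul]
    have := normSq_nonneg ζ
    gcongr
  have growth_nonneg : 0 ≤ ε * normSq z + K := add_nonneg (mul_nonneg hε (normSq_nonneg z)) hK
  norm_num at young shift
  linarith

/-- If `u` nearly attained its growth bound `X` at `z`, then `f` would nearly attain it at a point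
`z + ζ` with `|ζ|² = O(X)`. On a disc of the complex line through both points the bound hardly
changes, so by the submean value property `log⁺|f| + log⁺|u|` would be almost `2 X` somewhere,
whereas it is at most about `X`. -/
theorem growth_improvement (hf : Differentiable ℂ f) (hu : Differentiable ℂ u) (hε : 0 ≤ ε)
    (hε' : ε ≤ 1 / 10 ^ 6) (hK : 0 ≤ K) (hCK : 100 * C ≤ K)
    (hfK : ∀ z, log⁺ ‖f z‖ ≤ ε * normSq z + K) (huK : ∀ z, log⁺ ‖u z‖ ≤ ε * normSq z + K)
    (huf : ∀ z, log⁺ ‖u z‖ ≤ logEnvelope f z + C)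
    (hfu : ∀ z, log⁺ ‖f z‖ + log⁺ ‖u z‖ ≤ max (logEnvelope f z) (logEnvelope u z) + C)
    (z : Fin n → ℂ) : log⁺ ‖u z‖ ≤ 9 / 10 * (ε * normSq z + K) := by
  by_contra! large
  set X := ε * normSq z + K
  have εz_nonneg : 0 ≤ ε * normSq z := mul_nonneg hε (normSq_nonneg z)
  obtain ⟨ζ, hζ⟩ : ∃ ζ, 9 / 10 * X - C < log⁺ ‖f (z + ζ)‖ - normSq ζ / 4 :=
    exists_lt_of_lt_ciSup (by linarith [huf z] : 9 / 10 * X - C < logEnvelope f z)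
  have near : normSq ζ ≤ 5 * X := by
    have young := mul_normSq_add_add_le hε hK one_pos z ζ
    have small := mul_le_mul_of_nonneg_right hε' (normSq_nonneg ζ)
    norm_num at young small
    linarith [hfK (z + ζ), normSq_nonneg ζ]
  have growth : ∀ t : ℂ, ‖t‖ ≤ 3 → ε * normSq (z + t • ζ) + K ≤ 21 / 20 * X := fun t ht =>
    growth_along_line_le hε hε' hK near ht
  have envelope : ∀ {h : (Fin n → ℂ) → ℂ}, (∀ z, log⁺ ‖h z‖ ≤ ε * normSq z + K) →
      ∀ t : ℂ, ‖t‖ ≤ 3 → logEnvelope h (z + t • ζ) ≤ 27 / 25 * X := fun hh t ht => by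
    have := logEnvelope_le hε hK hh (a := 1 / 50) (by norm_num) (by norm_num; linarith) (z + t • ζ)
    linarith [growth t ht]
  have outer : ∀ t ∈ Metric.ball (1 : ℂ) 2, ‖t‖ ≤ 3 := fun t ht => by
    have := norm_le_norm_add_norm_sub' t 1
    rw [norm_one] at this
    linarith [mem_ball_iff_norm.1 ht]
  have subset : Metric.ball (0 : ℂ) 1 ⊆ Metric.ball 1 2 :=
    Metric.ball_subset_ball' (by norm_num)
  have two_discs := posLog_two_discs (a := fun t => f (z + t • ζ)) (b := fun t => u (z + t • ζ))
    (A := 21 / 20 * X) (P := 109 / 100 * X) (by fun_prop) (by fun_prop) zero_le_two zero_le_one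
    subset (fun t ht => (hfK _).trans (growth t (outer t ht))) fun t ht => by
      have ht' := outer t (subset ht)
      linarith [hfu (z + t • ζ), max_le (envelope hfK t ht') (envelope huK t ht')]
  simp only [one_smul, zero_smul, add_zero] at two_discs
  linarith [normSq_nonneg ζ]

end GrowthImprovement

section MutualDomination

variable {f u : (Fin n → ℂ) → ℂ} {C : ℝ}

theorem posLog_norm_le_geometric (hf : EntireSymbol f) (hu : EntireSymbol u) (hC : 0 ≤ C)
    (huf : ∀ z, log⁺ ‖u z‖ ≤ logEnvelope f z + C) (hfu : ∀ z, log⁺ ‖f z‖ ≤ logEnvelope u z + C)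
    (hprod : ∀ z, log⁺ ‖f z‖ + log⁺ ‖u z‖ ≤ max (logEnvelope f z) (logEnvelope u z) + C) :
    ∃ K, ∀ k : ℕ, (∀ z, log⁺ ‖f z‖ ≤ (9 / 10) ^ k * (1 / 10 ^ 6) * normSq z + K) ∧
      ∀ z, log⁺ ‖u z‖ ≤ (9 / 10) ^ k * (1 / 10 ^ 6) * normSq z + K := by
  obtain ⟨K₁, hK₁, hfK⟩ := hf.exists_posLog_norm_le (c := 1 / 10 ^ 6) (by norm_num)
  obtain ⟨K₂, hK₂, huK⟩ := hu.exists_posLog_norm_le (c := 1 / 10 ^ 6) (by norm_num)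
  refine ⟨100 * C + K₁ + K₂, fun k => ?_⟩
  induction k with
  | zero => exact ⟨fun z => by linarith [hfK z], fun z => by linarith [huK z]⟩
  | succ k ih =>
    obtain ⟨ihf, ihu⟩ := ih
    have rate_nonneg : (0 : ℝ) ≤ (9 / 10) ^ k * (1 / 10 ^ 6) := by positivity
    have rate_le : (9 / 10 : ℝ) ^ k * (1 / 10 ^ 6) ≤ 1 / 10 ^ 6 :=
      mul_le_of_le_one_left (by norm_num) (pow_le_one₀ (by norm_num) (by norm_num))
    have hprod' : ∀ z,
        log⁺ ‖u z‖ + log⁺ ‖f z‖ ≤ max (logEnvelope u z) (logEnvelope f z) + C := fun z => by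
      rw [add_comm (log⁺ ‖u z‖), max_comm]
      exact hprod z
    rw [pow_succ']
    constructor <;> intro z
    · linarith [growth_improvement hu.differentiable hf.differentiable rate_nonneg rate_le
        (by positivity) (by linarith) ihu ihf hfu hprod' z]
    · linarith [growth_improvement hf.differentiable hu.differentiable rate_nonneg rate_le
        (by positivity) (by linarith) ihf ihu huf hprod z]

theorem eq_of_mutual_domination (hf : EntireSymbol f) (hu : EntireSymbol u) (hC : 0 ≤ C)
    (huf : ∀ z, log⁺ ‖u z‖ ≤ logEnvelope f z + C) (hfu : ∀ z, log⁺ ‖f z‖ ≤ logEnvelope u z + C)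
    (hprod : ∀ z, log⁺ ‖f z‖ + log⁺ ‖u z‖ ≤ max (logEnvelope f z) (logEnvelope u z) + C)
    (z z' : Fin n → ℂ) : u z = u z' := by
  obtain ⟨K, hK⟩ := posLog_norm_le_geometric hf hu hC huf hfu hprod
  have bound : ∀ x, log⁺ ‖u x‖ ≤ K := fun x => by
    have rate : Tendsto (fun k : ℕ => (9 / 10 : ℝ) ^ k) atTop (𝓝 0) :=
      tendsto_pow_atTop_nhds_zero_of_lt_one (by norm_num) (by norm_num)
    have limit := ((rate.mul_const (1 / 10 ^ 6)).mul_const (normSq x)).add_const K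
    rw [zero_mul, zero_mul, zero_add] at limit
    exact ge_of_tendsto' limit fun k => (hK k).2 x
  refine hu.differentiable.apply_eq_apply_of_bounded ?_ z z'
  refine isBounded_iff_forall_norm_le.2 ⟨exp K, Set.forall_mem_range.2 fun x => ?_⟩
  exact (le_exp_posLog _).trans (exp_le_exp.2 (bound x))

end MutualDomination

section Polarization

variable {E : Type*} [NormedAddCommGroup E] [NormedSpace ℂ E]

theorem eq_const_of_eventually_eq {F : Type*} [NormedAddCommGroup F] [NormedSpace ℂ F]
    [CompleteSpace F] {h : E → F} (hh : Differentiable ℂ h) {z₀ : E} {c : F}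
    (hc : ∀ᶠ z in 𝓝 z₀, h z = c) (z : E) : h z = c := by
  have entire : Differentiable ℂ fun t : ℂ => h (z₀ + t • (z - z₀)) := by fun_prop
  have line : Tendsto (fun t : ℂ => z₀ + t • (z - z₀)) (𝓝 0) (𝓝 z₀) := by
    have : Continuous fun t : ℂ => z₀ + t • (z - z₀) := by fun_prop
    simpa using this.tendsto 0
  have eq_const := AnalyticOnNhd.eq_of_eventuallyEq (g := fun _ => c)
    (fun t _ => entire.analyticAt t) (fun _ _ => analyticAt_const) (line.eventually hc)
  simpa using congrFun eq_const 1

theorem eq_zero_or_eq_zero_of_polarized_mul_eq_zero {f g u v : E → ℂ} (hf : Continuous f)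
    (hg : Continuous g) (hu : Differentiable ℂ u) (hv : Differentiable ℂ v)
    (h : ∀ z w, (f z + conj (g w)) * (u z + conj (v w)) = 0) :
    (fun z => f z + conj (g z)) = 0 ∨ (fun z => u z + conj (v z)) = 0 := by
  refine or_iff_not_imp_left.2 fun hφ => ?_
  obtain ⟨z₀, hz₀⟩ : ∃ z₀, f z₀ + conj (g z₀) ≠ 0 := Function.ne_iff.1 hφ
  have u_eq : ∀ᶠ z in 𝓝 z₀, u z = -conj (v z₀) := by
    have near : ∀ᶠ z in 𝓝 z₀, f z + conj (g z₀) ≠ 0 :=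
      (hf.add continuous_const).continuousAt.eventually_ne hz₀
    filter_upwards [near] with z hz
    exact eq_neg_of_add_eq_zero_left ((mul_eq_zero.1 (h z z₀)).resolve_left hz)
  have v_eq : ∀ᶠ w in 𝓝 z₀, v w = -conj (u z₀) := by
    have near : ∀ᶠ w in 𝓝 z₀, f z₀ + conj (g w) ≠ 0 :=
      (continuous_const.add (Complex.continuous_conj.comp hg)).continuousAt.eventually_ne hz₀
    filter_upwards [near] with w hw
    have := eq_neg_of_add_eq_zero_right ((mul_eq_zero.1 (h z₀ w)).resolve_left hw)
    rw [← Complex.conj_conj (v w), this, map_neg]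
  funext z
  rw [Pi.zero_apply, eq_const_of_eventually_eq hu u_eq z, eq_const_of_eventually_eq hv v_eq z,
    ← v_eq.self_of_nhds, neg_add_cancel]

end Polarization

section BerezinIdentity

variable {f g u v : (Fin n → ℂ) → ℂ}

theorem exists_domination_of_berezin_identity (hf : EntireSymbol f) (hg : EntireSymbol g)
    (hu : EntireSymbol u) (hv : EntireSymbol v)
    (hB : ∀ z w,
      f z * u z + f z * conj (v w) + conj (g w) * conj (v w) + berezin u g z w = 0)
    {w₁ w₂ : Fin n → ℂ} (hg' : g w₁ ≠ g w₂) {w₃ w₄ : Fin n → ℂ} (hv' : v w₃ ≠ v w₄) :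
    u =O[⊤] (fun z => exp (logEnvelope f z)) ∧ f =O[⊤] (fun z => exp (logEnvelope u z)) ∧
      (fun z => f z * u z) =O[⊤] fun z => exp (logEnvelope u z) := by
  have conj_ne : ∀ {x y : ℂ}, x ≠ y → conj x ≠ conj y := (starRingEnd ℂ).injective.ne
  have huf : u =O[⊤] fun z => exp (logEnvelope f z) :=
    isBigO_of_add_mul_add_eq (p := fun z => f z * u z) (c := fun w => conj (g w))
      (q := fun w => conj (g w) * conj (v w))
      (r := fun z w => -berezin f (fun ζ => v (-ζ)) z (-w))
      (fun z w => by linear_combination berezin_identity_dual hf hg hu hv hB z w)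
      hf.isBigO_const (fun w => (hf.isBigO_berezin hv.comp_neg.toSlowGrowth (-w)).neg_left)
      (conj_ne hg')
  have hfu : f =O[⊤] fun z => exp (logEnvelope u z) :=
    isBigO_of_add_mul_add_eq (p := fun z => f z * u z) (c := fun w => conj (v w))
      (q := fun w => conj (g w) * conj (v w)) (r := fun z w => -berezin u g z w)
      (fun z w => by linear_combination hB z w)
      hu.isBigO_const (fun w => (hu.isBigO_berezin hg.toSlowGrowth w).neg_left) (conj_ne hv')
  refine ⟨huf, hfu, ?_⟩
  have solved : (fun z => f z * u z) = fun z =>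
      -(conj (v 0) * f z + conj (g 0) * conj (v 0) + berezin u g z 0) := by
    funext z
    linear_combination hB z 0
  rw [solved]
  exact (((hfu.const_mul_left _).add (hu.isBigO_const _)).add
    (hu.isBigO_berezin hg.toSlowGrowth 0)).neg_left

theorem eq_of_berezin_identity (hf : EntireSymbol f) (hg : EntireSymbol g)
    (hu : EntireSymbol u) (hv : EntireSymbol v)
    (hB : ∀ z w,
      f z * u z + f z * conj (v w) + conj (g w) * conj (v w) + berezin u g z w = 0)
    {w₁ w₂ : Fin n → ℂ} (hg' : g w₁ ≠ g w₂) {w₃ w₄ : Fin n → ℂ} (hv' : v w₃ ≠ v w₄)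
    (z z' : Fin n → ℂ) : u z = u z' := by
  obtain ⟨huf, hfu, hprod⟩ := exists_domination_of_berezin_identity hf hg hu hv hB hg' hv'
  obtain ⟨C₁, hC₁, huf⟩ := hf.exists_posLog_le_of_isBigO huf
  obtain ⟨C₂, hC₂, hfu⟩ := hu.exists_posLog_le_of_isBigO hfu
  obtain ⟨C₃, hC₃, hprod⟩ := hu.exists_posLog_le_of_isBigO hprod
  refine eq_of_mutual_domination hf hu (C := C₁ + C₂ + C₃) (by positivity)
    (fun z => by linarith [huf z]) (fun z => by linarith [hfu z]) (fun z => ?_) z z'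
  calc log⁺ ‖f z‖ + log⁺ ‖u z‖
      ≤ max (max (log⁺ ‖f z‖) (log⁺ ‖u z‖)) (log⁺ ‖f z * u z‖) := by
        rw [norm_mul]
        exact posLog_add_posLog_le_max _ _
    _ ≤ logEnvelope u z + (C₁ + C₂ + C₃) :=
        max_le (max_le (by linarith [hfu z]) (by linarith [hu.posLog_norm_le_logEnvelope z]))
          (by linarith [hprod z])
    _ ≤ max (logEnvelope f z) (logEnvelope u z) + (C₁ + C₂ + C₃) := by
        gcongr
        exact le_max_right _ _

theorem polarized_mul_eq_zero_of_berezin_identity (hf : EntireSymbol f) (hg : EntireSymbol g)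
    (hu : EntireSymbol u) (hv : EntireSymbol v)
    (hB : ∀ z w,
      f z * u z + f z * conj (v w) + conj (g w) * conj (v w) + berezin u g z w = 0)
    (z w : Fin n → ℂ) : (f z + conj (g w)) * (u z + conj (v w)) = 0 := by
  by_cases hg' : ∀ w, g w = g 0
  · have : berezin u g z w = u z * conj (g w) := by
      rw [funext hg', berezin_const_right hu]
    linear_combination hB z w - this
  by_cases hv' : ∀ w, v w = v 0
  · have : berezin f (fun ζ => v (-ζ)) z (-w) = f z * conj (v w) := by
      simp only [hv']
      exact berezin_const_right hf _ _ _
    linear_combination berezin_identity_dual hf hg hu hv hB z w - this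
  push Not at hg' hv'
  obtain ⟨w₁, hw₁⟩ := hg'
  obtain ⟨w₂, hw₂⟩ := hv'
  have hu' : ∀ z, u z = u 0 := fun z => eq_of_berezin_identity hf hg hu hv hB hw₁ hw₂ z 0
  have : berezin u g z w = u z * conj (g w) := by
    rw [funext hu', berezin_const_left hg]
  linear_combination hB z w - this

end BerezinIdentity

theorem toeplitzProductEqZero_zero_left (b : (Fin n → ℂ) → ℂ) : ToeplitzProductEqZero 0 b :=
  fun h _ => by
    funext z
    simp [toeplitz, projection]

theorem toeplitzProductEqZero_zero_right (a : (Fin n → ℂ) → ℂ) : ToeplitzProductEqZero a 0 :=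
  fun h _ => by
    funext z
    simp [toeplitz, projection]

end Fock

theorem corollaryc3 (n : ℕ) (f g u v φ ψ : (Fin n → ℂ) → ℂ)
    (hf : f ∈ Fock.symbolClass n) (hf' : Differentiable ℂ f)
    (hg : g ∈ Fock.symbolClass n) (hg' : Differentiable ℂ g)
    (hu : u ∈ Fock.symbolClass n) (hu' : Differentiable ℂ u)
    (hv : v ∈ Fock.symbolClass n) (hv' : Differentiable ℂ v)
    (hφ : φ = fun z => f z + conj (g z))
    (hψ : ψ = fun z => u z + conj (v z)) :
    Fock.ToeplitzProductEqZero φ ψ ↔ φ = 0 ∨ ψ = 0 := by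
  constructor
  · intro hT
    subst hφ hψ
    have f_symbol := Fock.EntireSymbol.of_mem_symbolClass hf hf'
    have g_symbol := Fock.EntireSymbol.of_mem_symbolClass hg hg'
    have u_symbol := Fock.EntireSymbol.of_mem_symbolClass hu hu'
    have v_symbol := Fock.EntireSymbol.of_mem_symbolClass hv hv'
    have identity := hT.berezin_identity f_symbol g_symbol u_symbol v_symbol
    exact Fock.eq_zero_or_eq_zero_of_polarized_mul_eq_zero hf'.continuous hg'.continuous hu' hv'
      (Fock.polarized_mul_eq_zero_of_berezin_identity f_symbol g_symbol u_symbol v_symbol identity)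
  · rintro (rfl | rfl)
    · exact Fock.toeplitzProductEqZero_zero_left ψ
    · exact Fock.toeplitzProductEqZero_zero_right φ
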